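/- Model. A synchronous network is an $n$-node simple graph $G=(V,E)$ of diameter $D$. Fix a constant $a$. Nodes have distinct identifiers in $\{0,\dots,n^{a}-1\}$. Initially each node knows only its own identifier, those of its neighbours, a number $N$ with $n\le N^{a}$ and $N\le n^{a}$, the integer $t\ge 1$, the communication model in use, and, if it is the source $s$, the message $m_0$ (a bit string); it knows neither $D$ nor the topology of $G$ nor the identity of $s$. All nodes start simultaneously. In each round every node sends a (possibly empty, possibly different) bit string to each of its neighbours; local computation is free. In the CONGEST model every message has at most $C\log_2 n$ bits (with $\log_2 n$ rounded down) and $m_0$ has at most $a\log_2 n$ bits (likewise rounded down); in the LOCAL model there is no restriction on lengths. A computationally unbounded, adaptive adversary that knows $G$, the algorithm and all messages exchanged controls a fixed set $F\subseteq E$ with $|F|\le t$, unknown to the nodes; in each round it replaces the messages on the edges of $F$, in each direction separately, by arbitrary messages of admissible length. Theorem (broadcast against $t$ adversarial edges). For every $a$ there are a constant $C$, depending only on $a$, and a deterministic algorithm such that for all $t\ge 1$, every $(2t+1)$-edge-connected graph $G$, every choice of identifiers, $N$, $s$ and $m_0$ as above, every $F$, and every behaviour of the adversary, all nodes terminate with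 output $m_0$ (i) within $(tD\log n)^{Ct}$ rounds in the CONGEST model, and (ii) within $C\,tD\log n$ rounds when the algorithm is implemented in the LOCAL model. -/

import Mathlib

namespace AdvBroadcast

/-- The two communication models: bandwidth-restricted (CONGEST) and unrestricted (LOCAL). -/
inductive CommModel where
  | congest
  | unrestricted

/-- Everything a node knows when the execution starts. -/
structure LocalInput where
  /-- which of the two models the network runs in -/
  model : CommModel
  /-- the known bound on the number of adversarial edges -/
  faultBound : ℕ
  /-- the known polynomial estimate of the number of nodes -/
  sizeEstimate : ℕ
  /-- the node's own identifier -/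
  ident : ℕ
  /-- the identifiers of its neighbours -/
  nbrs : Finset ℕ
  /-- the message to be broadcast, at the source; `none` at every other node -/
  message : Option (List Bool)

/-- A deterministic synchronous distributed algorithm, the same program at every node. Messages are
bit strings, the empty string being silence. Local computation is unrestricted. -/
structure Protocol where
  State : Type
  init : LocalInput → State
  /-- the message for the neighbour with the given identifier -/
  send : State → ℕ → List Bool
  /-- new state, from the old one and the messages received, indexed by neighbour identifiers -/
  receive : State → (ℕ → List Bool) → State
  /-- `some m` means that the node terminates with output `m` -/
  output : State → Option (List Bool)

/-- A network on the node set `V` with a broadcast task. -/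
structure BroadcastTask (V : Type) where
  graph : SimpleGraph V
  ident : V → ℕ
  sizeEstimate : ℕ
  faultBound : ℕ
  source : V
  message : List Bool

namespace BroadcastTask

variable {V : Type} [Fintype V]

/-- The standing assumptions. The natural number `a` is the constant hidden in "identifiers of
`O(log n)` bits" and in "polynomial estimate of `n`". -/
structure Admissible (I : BroadcastTask V) (a : ℕ) : Prop where
  ident_injective : Function.Injective I.ident
  ident_lt : ∀ v, I.ident v < Fintype.card V ^ a
  card_le : Fintype.card V ≤ I.sizeEstimate ^ a
  le_card : I.sizeEstimate ≤ Fintype.card V ^ a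
  one_le_faultBound : 1 ≤ I.faultBound
  edgeConnected : I.graph.IsEdgeConnected (2 * I.faultBound + 1)

open Classical in
/-- The initial knowledge of the node `v`. -/
noncomputable def localInput (I : BroadcastTask V) (M : CommModel) (v : V) : LocalInput where
  model := M
  faultBound := I.faultBound
  sizeEstimate := I.sizeEstimate
  ident := I.ident v
  nbrs := (Finset.univ.filter fun u => I.graph.Adj v u).image I.ident
  message := if v = I.source then some I.message else none

end BroadcastTask

section Execution

variable {V : Type}

/-- The message that `u`, in the state `q`, sends to its neighbour `v`; a node that has terminated
is silent. -/
def sentMsg (A : Protocol) (I : BroadcastTask V) (q : A.State) (v : V) : List Bool :=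
  if (A.output q).isSome then [] else A.send q (I.ident v)

open Classical in
/-- The message delivered from `u` (in the state `q u`) to `v` in a round in which the adversary
puts the message `x u v` on every adversarial edge `uv`, in the direction from `u` to `v`. -/
noncomputable def deliveredMsg (A : Protocol) (I : BroadcastTask V) (F : Finset (Sym2 V))
    (x : V → V → List Bool) (q : V → A.State) (u v : V) : List Bool :=
  if s(u, v) ∈ F then x u v else sentMsg A I (q u) v

open Classical in
/-- The messages that `v` receives, indexed by the identifiers of its neighbours. -/
noncomputable def inbox (A : Protocol) (I : BroadcastTask V) (F : Finset (Sym2 V))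
    (x : V → V → List Bool) (q : V → A.State) (v : V) : ℕ → List Bool :=
  Function.extend I.ident
    (fun u => if I.graph.Adj u v then deliveredMsg A I F x q u v else []) (fun _ => [])

/-- The states of all nodes after `r` rounds, when `x r u v` is the message that the adversary puts
on the adversarial edge `uv` from `u` to `v` in round `r`. A terminated node never changes its
state, so its output is final. -/
noncomputable def stateAt [Fintype V] (A : Protocol) (M : CommModel) (I : BroadcastTask V)
    (F : Finset (Sym2 V)) (x : ℕ → V → V → List Bool) : ℕ → V → A.State
  | 0 => fun v => A.init (I.localInput M v)
  | r + 1 => fun v =>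
      let q := stateAt A M I F x r
      if (A.output (q v)).isSome then q v else A.receive (q v) (inbox A I F (x r) q v)

/-- `A` solves the task `I` in the model `M` within `R` rounds, every message having at most `B`
bits: whatever set of at most `t` edges the adversary controls, and whatever messages of at most `B`
bits it puts on them, the nodes only send messages of at most `B` bits, and after some number
`T ≤ R` of rounds all nodes have terminated with the source's message as their output.
As `A` is deterministic, quantifying over all sequences `x` of adversarial messages covers every
adaptive adversary that knows the network, the protocol and all messages exchanged. -/
def SolvesWithin [Fintype V] (A : Protocol) (M : CommModel) (I : BroadcastTask V) (B : ℕ∞)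
    (R : ℝ) : Prop :=
  ∀ F : Finset (Sym2 V), (F : Set (Sym2 V)) ⊆ I.graph.edgeSet → F.card ≤ I.faultBound →
    ∀ x : ℕ → V → V → List Bool, (∀ r u v, ((x r u v).length : ℕ∞) ≤ B) →
      (∀ r u v, I.graph.Adj u v →
        ((sentMsg A I (stateAt A M I F x r u) v).length : ℕ∞) ≤ B) ∧
      ∃ T : ℕ, (T : ℝ) ≤ R ∧ ∀ v, A.output (stateAt A M I F x T v) = some I.message

end Execution

end AdvBroadcast

namespace AdvBroadcast

/-! Nodes collect evidence `(P, m)`: an edge set `P` and a message `m` that is supposed to have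
travelled inside `P`. The receiver itself adds the edge over which a message came, so whatever the
adversary injects is recorded together with a faulty edge, and evidence for a wrong message always
meets the fault set (`nodeAt_sound`). A node accepts `m` when no `t` edges meet all its evidence for
`m`; testing this with the true fault set shows that only the source's message can be accepted.

Conversely, let `X` be any set of `t` edges. Deleting `X` and the fault set removes at most `2t`
edges, so the graph stays connected, and by `dist_deleteEdges_le` its distances are at most
`(4t+1)(2D+1)`. Every node is thus joined to the source by an intact walk of length `O(tD)` avoiding
`X` (`exists_intact_walk`), and once information has passed along such a walk for every `X`, the
node accepts (`all_terminate`).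

In LOCAL all evidence is relayed in every round, so `O(tD)` rounds suffice. In CONGEST the edge set
cannot be transmitted, so it is fixed by the schedule: the nodes flood inside each member `S` of a
family that, for any `L` edges and any other `2t` edges, has a member containing the former and
avoiding the latter (`exists_mem_coveringFamily`). Residues of edge codes modulo small numbers give
such a family of size polynomial in `L`, `t` and the identifier length, to the power `2t+1`. As `D`
is unknown, `L` runs through 1, 2, 3, and so on.

A node falls silent on terminating, but its last transmission hands its message to its neighbours,
so terminated nodes do not block walks (`evidence_of_terminated`). -/

/-! ### Distances after deleting few edges. -/

/-- Along a walk to `s`, an edge-deleted graph still leads to `s` or to an end of a deleted edge. -/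
lemma exists_walk_deleteEdges_to_center {V : Type*} [DecidableEq V] {G : SimpleGraph V}
    (X : Finset (Sym2 V)) {x s : V} (p : G.Walk x s) :
    ∃ c ∈ insert s (X.biUnion Sym2.toFinset),
      ∃ q : (G.deleteEdges (X : Set (Sym2 V))).Walk x c, q.length ≤ p.length := by
  induction p with
  | nil => exact ⟨_, Finset.mem_insert_self _ _, .nil, le_rfl⟩
  | @cons x y s h p ih =>
    by_cases hX : s(x, y) ∈ X
    · refine ⟨x, Finset.mem_insert_of_mem (Finset.mem_biUnion.2 ⟨_, hX, by simp⟩), .nil, ?_⟩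
      simp
    · obtain ⟨c, hc, q, hq⟩ := ih
      refine ⟨c, hc, .cons (SimpleGraph.deleteEdges_adj.2 ⟨h, by simpa using hX⟩) q, ?_⟩
      simpa using hq

/-- Deleting few edges from a highly edge-connected graph stretches its diameter only linearly in
the number of deleted edges. -/
lemma dist_deleteEdges_le {V : Type*} [Finite V] {G : SimpleGraph V} {k : ℕ}
    (hG : G.IsEdgeConnected (k + 1)) (X : Finset (Sym2 V)) (hX : X.card ≤ k) (s v : V) :
    (G.deleteEdges (X : Set (Sym2 V))).dist s v ≤ (2 * k + 1) * (2 * G.diam + 1) := by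
  classical
  have : Nonempty V := ⟨s⟩
  set H := G.deleteEdges (X : Set (Sym2 V)) with hH
  have hHc : H.Connected :=
    ⟨fun u v => hG u v (by
      rw [Set.encard_coe_eq_coe_finsetCard]; exact_mod_cast Nat.lt_succ_of_le hX)⟩
  have hGc : G.Connected := hG.connected (by simp)
  -- Following a shortest walk of `G` from `x` to `s` until it reaches a deleted edge shows that the
  -- at most `2k+1` centers, `s` and the ends of deleted edges, are `G.diam`-dense in `H`.
  have hcenter : ∀ x, ∃ c ∈ insert s (X.biUnion Sym2.toFinset), H.dist x c ≤ G.diam := by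
    intro x
    obtain ⟨p, hp⟩ := hGc.exists_walk_length_eq_dist x s
    obtain ⟨c, hc, q, hq⟩ := exists_walk_deleteEdges_to_center X p
    refine ⟨c, hc, (SimpleGraph.dist_le q).trans (hq.trans (hp.le.trans ?_))⟩
    exact SimpleGraph.dist_le_diam (SimpleGraph.connected_iff_ediam_ne_top.1 hGc)
  have hcard : (insert s (X.biUnion Sym2.toFinset)).card ≤ 2 * k + 1 := by
    refine (Finset.card_insert_le _ _).trans (Nat.succ_le_succ ?_)
    refine (Finset.card_biUnion_le_card_mul X _ 2 fun e _ => ?_).trans (by omega)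
    rw [Sym2.card_toFinset]
    split <;> omega
  by_contra! hlt
  have hlevel : ∀ i ≤ H.dist s v, ∃ x, H.dist s x = i := by
    intro i hi
    obtain ⟨p, hp⟩ := hHc.exists_walk_length_eq_dist s v
    refine ⟨p.getVert i, le_antisymm ?_ ?_⟩
    · exact (SimpleGraph.dist_le (p.take i)).trans (by simp)
    · have h1 : H.dist (p.getVert i) v ≤ p.length - i :=
        (SimpleGraph.dist_le (p.drop i)).trans (by simp)
      have h2 := hHc.dist_triangle (u := s) (v := p.getVert i) (w := v)
      omega
  choose! x hx using hlevel
  choose c hc hcd using hcenter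
  -- Pigeonhole on `2k+2` vertices at distances `i * (2 * G.diam + 1)` from `s`: two share a center,
  -- so they are within `2 * G.diam` of each other, less than the gap between their distances from
  -- `s`.
  obtain ⟨i, hi, j, hj, hij, hcc⟩ := Finset.exists_ne_map_eq_of_card_lt_of_maps_to
    (s := Finset.range (2 * k + 2)) (t := insert s (X.biUnion Sym2.toFinset))
    (by rw [Finset.card_range]; omega) (f := fun i => c (x (i * (2 * G.diam + 1))))
    (fun i _ => hc _)
  wlog hlt' : i < j generalizing i j
  · exact this j hj i hi hij.symm hcc.symm (by omega)
  simp only [Finset.mem_range] at hi hj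
  have hle : ∀ i < 2 * k + 2, H.dist s (x (i * (2 * G.diam + 1))) = i * (2 * G.diam + 1) := by
    intro i hi
    refine hx _ (le_trans (Nat.mul_le_mul_right _ (by omega)) hlt.le)
  have h1 := hHc.dist_triangle (u := s) (v := x (i * (2 * G.diam + 1)))
    (w := x (j * (2 * G.diam + 1)))
  have h2 := hHc.dist_triangle (u := x (i * (2 * G.diam + 1)))
    (v := c (x (i * (2 * G.diam + 1)))) (w := x (j * (2 * G.diam + 1)))
  have h3 := hcd (x (i * (2 * G.diam + 1)))
  have h4 := hcd (x (j * (2 * G.diam + 1)))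
  rw [H.dist_comm] at h4
  rw [← hcc] at h4
  rw [hle i hi, hle j hj] at h1
  have h5 : (i + 1) * (2 * G.diam + 1) ≤ j * (2 * G.diam + 1) := Nat.mul_le_mul_right _ hlt'
  rw [add_mul] at h5
  omega

/-! ### Separating moduli and covering families of edge sets. -/

/-- Stands in for a lower bound on the least common multiple of `1, …, 2k`, which the central
binomial coefficient divides. -/
lemma two_pow_le_centralBinom (k : ℕ) : 2 ^ k ≤ k.centralBinom := by
  induction k with
  | zero => simp
  | succ k ih =>
    have h := Nat.succ_mul_centralBinom_succ k
    have : (k + 1) * 2 ^ (k + 1) ≤ (k + 1) * (k + 1).centralBinom := by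
      rw [h, pow_succ]
      nlinarith [Nat.zero_le k, Nat.mul_le_mul_left k ih]
    exact Nat.le_of_mul_le_mul_left this (by omega)

/-- A positive number below `2 ^ k` has a non-divisor among `1, …, 2 * k`. -/
lemma exists_not_dvd_of_lt_two_pow {k z : ℕ} (hz : z ≠ 0) (hzk : z < 2 ^ k) :
    ∃ q, 1 ≤ q ∧ q ≤ 2 * k ∧ ¬ q ∣ z := by
  by_contra! hall
  have hk : k ≠ 0 := by rintro rfl; simp at hzk; exact hz hzk
  -- Each prime power exactly dividing the central binomial coefficient is at most `2k`, hence among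
  -- the supposed divisors of `z`.
  have hdvd : k.centralBinom ∣ z := by
    rw [← Nat.factorization_prime_le_iff_dvd k.centralBinom_ne_zero hz]
    intro p hp
    rw [← hp.pow_dvd_iff_le_factorization hz]
    refine hall _ (Nat.one_le_pow _ _ hp.pos) ?_
    exact Nat.pow_factorization_choose_le (by omega)
  have := Nat.le_of_dvd (Nat.pos_of_ne_zero hz) hdvd
  have := two_pow_le_centralBinom k
  omega

/-- Two disjoint small sets of numbers of at most `l` bits are separated by a small modulus. -/
lemma exists_separating_modulus {A B : Finset ℕ} {α β l : ℕ} (hA : A.card ≤ α) (hB : B.card ≤ β)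
    (hAl : ∀ x ∈ A, x < 2 ^ l) (hBl : ∀ x ∈ B, x < 2 ^ l) (hAB : Disjoint A B) :
    ∃ q, 1 ≤ q ∧ q ≤ 2 * (α * β * l + 1) ∧ ∀ x ∈ A, ∀ y ∈ B, x % q ≠ y % q := by
  -- Take `z` to be the product of all differences: it is nonzero by disjointness, and a non-divisor
  -- of `z` divides none of its factors.
  obtain ⟨q, hq1, hq, hnd⟩ := exists_not_dvd_of_lt_two_pow (k := α * β * l + 1)
    (z := ∏ p ∈ A ×ˢ B, ((p.1 : ℤ) - p.2).natAbs) (by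
      rw [Finset.prod_ne_zero_iff]
      rintro ⟨x, y⟩ hxy
      rw [Finset.mem_product] at hxy
      have : x ≠ y := fun h => Finset.disjoint_left.1 hAB hxy.1 (h ▸ hxy.2)
      simp only
      omega) (by
      refine lt_of_le_of_lt (Finset.prod_le_pow_card _ _ (2 ^ l) ?_) ?_
      · rintro ⟨x, y⟩ hxy
        rw [Finset.mem_product] at hxy
        have h1 := hAl x hxy.1
        have h2 := hBl y hxy.2
        simp only at h1 h2 ⊢
        zify at h1 h2 ⊢
        rw [abs_le]
        constructor <;> linarith [Int.natCast_nonneg x, Int.natCast_nonneg y]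
      · rw [← pow_mul, Finset.card_product]
        refine Nat.pow_lt_pow_right (by norm_num) (Nat.lt_succ_of_le ?_)
        calc l * (A.card * B.card) ≤ l * (α * β) := by gcongr
          _ = α * β * l := by ring)
  refine ⟨q, hq1, hq, fun x hx y hy hxy => hnd ?_⟩
  refine dvd_trans ?_ (Finset.dvd_prod_of_mem _ (Finset.mem_product.2 ⟨hx, hy⟩ : (x, y) ∈ A ×ˢ B))
  rw [← Int.natCast_dvd]
  exact Nat.modEq_iff_dvd.1 (Nat.ModEq.symm hxy)

/-- An injective numbering of the unordered pairs of natural numbers. -/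
def edgeCode (e : Sym2 ℕ) : ℕ := Nat.pair e.inf e.sup

lemma edgeCode_injective : Function.Injective edgeCode := by
  intro e f h
  obtain ⟨h1, h2⟩ := Nat.pair_eq_pair.1 h
  exact Sym2.sortEquiv.injective (Subtype.ext (Prod.ext h1 h2))

/-- Pairs of `l`-bit identifiers have codes of `2l` bits, whence the `2 * l` in `modulusBound`. -/
lemma edgeCode_lt {b : ℕ} {e : Sym2 ℕ} (he : e ∈ (Finset.range b).sym2) : edgeCode e < b ^ 2 := by
  induction e with
  | _ x y =>
    rw [Finset.mk_mem_sym2_iff, Finset.mem_range, Finset.mem_range] at he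
    refine lt_of_lt_of_le (Nat.pair_lt_max_add_one_sq _ _) (Nat.pow_le_pow_left ?_ 2)
    simp only [Sym2.inf_mk, Sym2.sup_mk]
    omega

/-- The edges between identifiers below `b` whose code modulo `q` is not in the list `R`. -/
def residueFilter (b q : ℕ) (R : List ℕ) : Finset (Sym2 ℕ) :=
  (Finset.range b).sym2.filter fun e => edgeCode e % q ∉ R

/-- All lists of length `k` of numbers below `m`. -/
def boundedLists (m : ℕ) : ℕ → List (List ℕ)
  | 0 => [[]]
  | k + 1 => (List.range m).flatMap fun x => (boundedLists m k).map (x :: ·)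

lemma length_boundedLists (m k : ℕ) : (boundedLists m k).length = m ^ k := by
  induction k with
  | zero => rfl
  | succ k ih => simp [boundedLists, List.length_flatMap, ih, pow_succ, mul_comm]

lemma mem_boundedLists {m k : ℕ} {l : List ℕ} (hl : l.length = k) (hm : ∀ x ∈ l, x < m) :
    l ∈ boundedLists m k := by
  induction k generalizing l with
  | zero => simp [boundedLists, List.length_eq_zero_iff.1 hl]
  | succ k ih =>
    obtain _ | ⟨x, l⟩ := l
    · simp at hl
    · simp only [List.length_cons, Nat.add_right_cancel_iff] at hl
      simp only [List.mem_cons, forall_eq_or_imp] at hm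
      simp only [boundedLists, List.mem_flatMap, List.mem_range, List.mem_map]
      exact ⟨x, hm.1, l, ih hl hm.2, rfl⟩

/-- The largest modulus needed to separate `α` from `β` edges between identifiers below `2 ^ l`. -/
def modulusBound (α β l : ℕ) : ℕ := 2 * (α * β * (2 * l) + 1)

/-- A family of edge sets that separates every `α` edges from every other `β` edges, as long as the
identifiers are below `2 ^ l`. -/
def coveringFamily (α β l : ℕ) : List (Finset (Sym2 ℕ)) :=
  (boundedLists (modulusBound α β l + 1) (β + 1)).map fun
    | [] => ∅
    | q :: R => residueFilter (2 ^ l) q R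

lemma length_coveringFamily (α β l : ℕ) :
    (coveringFamily α β l).length = (modulusBound α β l + 1) ^ (β + 1) := by
  simp [coveringFamily, length_boundedLists]

/-- If `q` separates the codes of `A` from those of `B`, the edges whose residue is not a residue of
`B` form the required set. It is described by `q` and `β` residues, hence the exponent `β + 1` in
the size of the family. -/
lemma exists_mem_coveringFamily {α β l : ℕ} {A B : Finset (Sym2 ℕ)} (hA : A.card ≤ α)
    (hB : B.card ≤ β) (hAl : A ⊆ (Finset.range (2 ^ l)).sym2) (hAB : Disjoint A B) :
    ∃ S ∈ coveringFamily α β l, A ⊆ S ∧ Disjoint S B := by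
  classical
  -- Edges of `B` with larger identifiers lie in no member of the family and would spoil the bound
  -- on the codes.
  set B' := B ∩ (Finset.range (2 ^ l)).sym2 with hB'
  have hB'c : B'.card ≤ β := (Finset.card_le_card Finset.inter_subset_left).trans hB
  have hcode : ∀ C ⊆ (Finset.range (2 ^ l)).sym2, ∀ x ∈ C.image edgeCode, x < 2 ^ (2 * l) := by
    intro C hC x hx
    obtain ⟨e, he, rfl⟩ := Finset.mem_image.1 hx
    have := edgeCode_lt (hC he)
    rwa [← pow_mul, mul_comm] at this
  obtain ⟨q, hq1, hq, hsep⟩ := exists_separating_modulus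
    (Finset.card_image_le.trans hA) (Finset.card_image_le.trans hB'c)
    (hcode A hAl) (hcode B' Finset.inter_subset_right)
    ((Finset.disjoint_image edgeCode_injective).2 (hAB.mono_right Finset.inter_subset_left))
  have hq' : q ≤ modulusBound α β l := hq
  set R₀ := B'.toList.map fun e => edgeCode e % q with hR₀
  -- The list is padded to length `β` with `q`, which is never a residue modulo `q`.
  set R := R₀ ++ List.replicate (β - B'.card) q with hR
  have hlt : ∀ e, edgeCode e % q < q := fun e => Nat.mod_lt _ hq1
  have hRmem : ∀ e, edgeCode e % q ∈ R ↔ ∃ f ∈ B', edgeCode f % q = edgeCode e % q := by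
    intro e
    simp only [hR, hR₀, List.mem_append, List.mem_map, Finset.mem_toList, List.mem_replicate]
    have := hlt e
    constructor
    · rintro (h | h)
      · exact h
      · omega
    · exact Or.inl
  refine ⟨residueFilter (2 ^ l) q R, ?_, ?_, ?_⟩
  · refine List.mem_map.2 ⟨q :: R, mem_boundedLists ?_ ?_, rfl⟩
    · simp [hR, hR₀]; omega
    · intro x hx
      simp only [hR, hR₀, List.mem_cons, List.mem_append, List.mem_map, List.mem_replicate] at hx
      rcases hx with rfl | ⟨e, -, rfl⟩ | ⟨-, rfl⟩
      · omega
      · have := hlt e; omega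
      · omega
  · intro e he
    refine Finset.mem_filter.2 ⟨hAl he, fun h => ?_⟩
    obtain ⟨f, hf, hfe⟩ := (hRmem e).1 h
    exact hsep _ (Finset.mem_image_of_mem _ he) _ (Finset.mem_image_of_mem _ hf) hfe.symm
  · rw [Finset.disjoint_left]
    intro e he heB
    obtain ⟨heU, heR⟩ := Finset.mem_filter.1 he
    exact heR ((hRmem e).2 ⟨e, Finset.mem_inter.2 ⟨heB, heU⟩, rfl⟩)

/-! ### The protocol. -/

/-- What the nodes do in one round: relay all evidence, announce accepted messages, or flood inside
a fixed edge set. -/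
inductive Slot where
  | relayAll
  | announce
  | flood (S : Finset (Sym2 ℕ))

/-- The edge set `P` together with a message that was received along edges of `P` only. -/
abbrev Evidence := Finset (Sym2 ℕ) × List Bool

/-- A unary code is enough, as only the LOCAL schedule uses it. Nonemptiness keeps it apart from
silence. -/
lemma exists_evidence_encoding :
    ∃ f : Finset Evidence → List Bool, Function.Injective f ∧ ∀ X, f X ≠ [] := by
  have : Countable (Sym2 ℕ) := inferInstanceAs (Countable (Quot _))
  obtain ⟨f, hf⟩ := exists_injective_nat (Finset Evidence)
  refine ⟨fun X => List.replicate (f X + 1) true, fun X Y h => hf ?_, fun X => by simp⟩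
  simpa using congrArg List.length h

/-- An injective encoding of finite sets of evidence by nonempty bit strings. -/
noncomputable def encodeEvidence : Finset Evidence → List Bool :=
  exists_evidence_encoding.choose

open Classical in
/-- A left inverse of `encodeEvidence` that reads silence as no evidence. -/
noncomputable def decodeEvidence (l : List Bool) : Finset Evidence :=
  if h : ∃ X, encodeEvidence X = l then h.choose else ∅

lemma decodeEvidence_encodeEvidence (X : Finset Evidence) :
    decodeEvidence (encodeEvidence X) = X := by
  have h : ∃ Y, encodeEvidence Y = encodeEvidence X := ⟨X, rfl⟩
  rw [decodeEvidence, dif_pos h]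
  exact exists_evidence_encoding.choose_spec.1 h.choose_spec

lemma decodeEvidence_nil : decodeEvidence [] = ∅ :=
  dif_neg fun ⟨X, h⟩ => exists_evidence_encoding.choose_spec.2 X h

/-- No `t` edges meet all the evidence for `m`. -/
def Convincing (t : ℕ) (ev : Finset Evidence) (m : List Bool) : Prop :=
  ∀ X : Finset (Sym2 ℕ), X.card ≤ t → ∃ P, (P, m) ∈ ev ∧ Disjoint P X

/-- The state of a node: its input, the round number, the evidence collected and the output. -/
structure NodeState where
  inp : LocalInput
  clock : ℕ
  ev : Finset Evidence
  out : Option (List Bool)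

open Classical in
/-- The message a node is certain of, if any. -/
noncomputable def NodeState.accepted (q : NodeState) : Option (List Bool) :=
  match q.inp.message with
  | some m => some m
  | none => if h : ∃ m, Convincing q.inp.faultBound q.ev m then some h.choose else none

open Classical in
/-- The bit string a node sends in a given slot. -/
noncomputable def NodeState.transmit (q : NodeState) : Slot → List Bool
  | .relayAll => encodeEvidence (match q.accepted with
      | some m => {(∅, m)}
      | none => q.ev)
  | .announce => match q.accepted with
      | some m => true :: m
      | none => []
  | .flood S => if h : ∃ m, ∃ P ⊆ S, (P, m) ∈ q.ev then true :: h.choose else []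

/-- The evidence contained in a bit string received in a given slot, without the last edge. -/
noncomputable def items : Slot → List Bool → Finset Evidence
  | .relayAll, l => decodeEvidence l
  | .announce, true :: m => {(∅, m)}
  | .flood S, true :: m => {(S, m)}
  | _, _ => ∅

lemma items_nil (sl : Slot) : items sl [] = ∅ := by
  cases sl <;> simp [items, decodeEvidence_nil]

/-- All nodes collect evidence according to the schedule `σ`, which depends on the model, the fault
bound and the size estimate, and terminate after announcing an accepted message. -/
noncomputable def evidenceProtocol (σ : CommModel → ℕ → ℕ → ℕ → Slot) : Protocol where
  State := NodeState
  -- A node without neighbours outputs at once: for `n = 1` the round bounds are 0.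
  init inp := ⟨inp, 0, ∅, if inp.nbrs = ∅ then inp.message else none⟩
  send q _ := q.transmit (σ q.inp.model q.inp.faultBound q.inp.sizeEstimate q.clock)
  receive q x :=
    let sl := σ q.inp.model q.inp.faultBound q.inp.sizeEstimate q.clock
    { inp := q.inp
      clock := q.clock + 1
      ev := q.ev ∪ q.inp.nbrs.biUnion fun u =>
        (items sl (x u)).image fun e => (insert s(q.inp.ident, u) e.1, e.2)
      -- Termination is decided by the state before the round, the same state that `send` used, so
      -- the accepted message has just been sent to all neighbours.
      out := match sl with
        | .flood _ => none
        | _ => q.accepted }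
  output q := q.out

/-! ### Unfolding the execution. -/

section Execution

variable {V : Type} [Fintype V] (σ : CommModel → ℕ → ℕ → ℕ → Slot) (M : CommModel)
  (I : BroadcastTask V) (F : Finset (Sym2 V)) (x : ℕ → V → V → List Bool)

/-- The state of the node `v` after `r` rounds. -/
noncomputable def nodeAt (r : ℕ) (v : V) : NodeState :=
  stateAt (evidenceProtocol σ) M I F x r v

/-- The slot of round `r`. -/
def slotOf (r : ℕ) : Slot := σ M I.faultBound I.sizeEstimate r

lemma nodeAt_zero (v : V) : nodeAt σ M I F x 0 v =
    (evidenceProtocol σ).init (I.localInput M v) := rfl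

lemma nodeAt_succ_of_out {r : ℕ} {v : V} (h : (nodeAt σ M I F x r v).out ≠ none) :
    nodeAt σ M I F x (r + 1) v = nodeAt σ M I F x r v := by
  have : ((evidenceProtocol σ).output (stateAt (evidenceProtocol σ) M I F x r v)).isSome := by
    rw [← Option.ne_none_iff_isSome]; exact h
  simp only [nodeAt, stateAt]
  rw [if_pos this]

lemma nodeAt_succ {r : ℕ} {v : V} (h : (nodeAt σ M I F x r v).out = none) :
    nodeAt σ M I F x (r + 1) v = (evidenceProtocol σ).receive (nodeAt σ M I F x r v)
      (inbox (evidenceProtocol σ) I F (x r) (nodeAt σ M I F x r) v) := by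
  have : ¬ ((evidenceProtocol σ).output (stateAt (evidenceProtocol σ) M I F x r v)).isSome := by
    rw [← Option.ne_none_iff_isSome]; exact not_not_intro h
  simp only [nodeAt, stateAt]
  rw [if_neg this]
  rfl

lemma nodeAt_inp (r : ℕ) (v : V) : (nodeAt σ M I F x r v).inp = I.localInput M v := by
  induction r with
  | zero => rfl
  | succ r ih =>
    by_cases h : (nodeAt σ M I F x r v).out = none
    · rw [nodeAt_succ _ _ _ _ _ h]; exact ih
    · rw [nodeAt_succ_of_out _ _ _ _ _ h, ih]

lemma nodeAt_clock {r : ℕ} {v : V} (h : (nodeAt σ M I F x r v).out = none) :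
    (nodeAt σ M I F x r v).clock = r := by
  induction r with
  | zero => rfl
  | succ r ih =>
    by_cases h' : (nodeAt σ M I F x r v).out = none
    · rw [nodeAt_succ _ _ _ _ _ h']
      exact congrArg (· + 1) (ih h')
    · rw [nodeAt_succ_of_out _ _ _ _ _ h'] at h
      exact absurd h h'

lemma out_mono {r r' : ℕ} (hr : r ≤ r') {v : V} (h : (nodeAt σ M I F x r v).out ≠ none) :
    nodeAt σ M I F x r' v = nodeAt σ M I F x r v := by
  induction r', hr using Nat.le_induction with
  | base => rfl
  | succ k hk ih => rw [nodeAt_succ_of_out _ _ _ _ _ (by rwa [ih]), ih]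

/-- The bit string that `u` really sends in round `r`. -/
noncomputable def sentAt (r : ℕ) (u : V) : List Bool :=
  if (nodeAt σ M I F x r u).out = none then (nodeAt σ M I F x r u).transmit (slotOf σ M I r) else []

lemma sentMsg_eq (r : ℕ) (u v : V) :
    sentMsg (evidenceProtocol σ) I (stateAt (evidenceProtocol σ) M I F x r u) v =
      sentAt σ M I F x r u := by
  change (if (nodeAt σ M I F x r u).out.isSome then []
    else (nodeAt σ M I F x r u).transmit (σ (nodeAt σ M I F x r u).inp.model
      (nodeAt σ M I F x r u).inp.faultBound (nodeAt σ M I F x r u).inp.sizeEstimate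
      (nodeAt σ M I F x r u).clock)) = _
  by_cases h : (nodeAt σ M I F x r u).out = none
  · rw [nodeAt_inp, nodeAt_clock _ _ _ _ _ h, sentAt, if_pos h, h]
    rfl
  · rw [sentAt, if_neg h, if_pos (Option.ne_none_iff_isSome.1 h)]

open Classical in
/-- The bit string delivered from `u` to `v` in round `r`. -/
noncomputable def deliveredAt (r : ℕ) (u v : V) : List Bool :=
  if s(u, v) ∈ F then x r u v else sentAt σ M I F x r u

lemma inbox_eq (hI : Function.Injective I.ident) {r : ℕ} {u v : V} (h : I.graph.Adj u v) :
    inbox (evidenceProtocol σ) I F (x r) (nodeAt σ M I F x r) v (I.ident u) =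
      deliveredAt σ M I F x r u v := by
  rw [deliveredAt, ← sentMsg_eq (v := v)]
  unfold inbox
  rw [hI.extend_apply, if_pos h]
  rfl

variable {σ M I F x}

lemma mem_ev_succ (hI : Function.Injective I.ident) {r : ℕ} {v : V}
    (h : (nodeAt σ M I F x r v).out = none) {e : Evidence} :
    e ∈ (nodeAt σ M I F x (r + 1) v).ev ↔ e ∈ (nodeAt σ M I F x r v).ev ∨
      ∃ u, I.graph.Adj u v ∧ ∃ P,
        (P, e.2) ∈ items (slotOf σ M I r) (deliveredAt σ M I F x r u v) ∧
        e.1 = insert s(I.ident u, I.ident v) P := by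
  have hn : ∀ u : V, u ∈ (Finset.univ : Finset V) := Finset.mem_univ
  rw [nodeAt_succ _ _ _ _ _ h]
  simp only [evidenceProtocol, nodeAt_inp, nodeAt_clock _ _ _ _ _ h, Finset.mem_union,
    Finset.mem_biUnion, Finset.mem_image, BroadcastTask.localInput, Finset.mem_filter, hn,
    true_and, exists_exists_and_eq_and]
  refine or_congr Iff.rfl (exists_congr fun u => ?_)
  rw [I.graph.adj_comm]
  refine and_congr_right fun hadj => ?_
  have := inbox_eq σ M I F x hI (r := r) hadj
  simp only [evidenceProtocol] at this
  rw [this]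
  constructor
  · rintro ⟨⟨P, m⟩, h1, rfl⟩
    exact ⟨P, h1, by rw [Sym2.eq_swap]⟩
  · rintro ⟨P, h1, h2⟩
    exact ⟨(P, e.2), h1, by rw [Sym2.eq_swap, ← h2]⟩

lemma out_succ {r : ℕ} {v : V} (h : (nodeAt σ M I F x r v).out = none) :
    (nodeAt σ M I F x (r + 1) v).out = match slotOf σ M I r with
      | .flood _ => none
      | _ => (nodeAt σ M I F x r v).accepted := by
  rw [nodeAt_succ _ _ _ _ _ h]
  simp only [evidenceProtocol, nodeAt_inp, nodeAt_clock _ _ _ _ _ h]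
  rfl

lemma ev_mono (hI : Function.Injective I.ident) {r r' : ℕ} (hr : r ≤ r') (v : V) :
    (nodeAt σ M I F x r v).ev ⊆ (nodeAt σ M I F x r' v).ev := by
  induction r', hr using Nat.le_induction with
  | base => rfl
  | succ k hk ih =>
    refine ih.trans fun e he => ?_
    by_cases h : (nodeAt σ M I F x k v).out = none
    · exact (mem_ev_succ hI h).2 (Or.inl he)
    · rwa [nodeAt_succ_of_out _ _ _ _ _ h]

end Execution

/-! ### Soundness: only the source's message is accepted. -/

/-- Evidence for a wrong message meets the faulty edges `X`. -/
def Evidence.Sound (m₀ : List Bool) (X : Finset (Sym2 ℕ)) (e : Evidence) : Prop :=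
  e.2 = m₀ ∨ ¬ Disjoint e.1 X

lemma Evidence.Sound.mono {m₀ m : List Bool} {X P Q : Finset (Sym2 ℕ)} (hPQ : P ⊆ Q)
    (h : Evidence.Sound m₀ X (P, m)) : Evidence.Sound m₀ X (Q, m) :=
  h.imp id fun h h' => h (h'.mono_left hPQ)

/-- The fault set is one of the sets `X` over which `Convincing` quantifies. -/
lemma Convincing.eq_of_sound {t : ℕ} {ev : Finset Evidence} {m m₀ : List Bool}
    {X : Finset (Sym2 ℕ)} (h : Convincing t ev m) (hX : X.card ≤ t)
    (hs : ∀ e ∈ ev, e.Sound m₀ X) : m = m₀ := by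
  obtain ⟨P, hP, hd⟩ := h X hX
  exact (hs _ hP).resolve_right (not_not_intro hd)

/-- The state of a node that holds sound evidence only and has not been given a wrong message. -/
structure NodeState.Sound (m₀ : List Bool) (X : Finset (Sym2 ℕ)) (q : NodeState) : Prop where
  ev : ∀ e ∈ q.ev, e.Sound m₀ X
  message : ∀ m, q.inp.message = some m → m = m₀
  card_le : X.card ≤ q.inp.faultBound

lemma NodeState.Sound.accepted_eq {m₀ m : List Bool} {X : Finset (Sym2 ℕ)} {q : NodeState}
    (h : q.Sound m₀ X) (hm : q.accepted = some m) : m = m₀ := by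
  rw [accepted] at hm
  split at hm
  · next m' hm' => exact h.message _ (hm'.trans hm)
  · split_ifs at hm with hc
    rw [← Option.some.inj hm]
    exact hc.choose_spec.eq_of_sound h.card_le h.ev

/-- Flooding replaces `P` by a larger set `S`, which still meets the faults. An accepted message is
correct, so it may be sent with the empty edge set. -/
lemma NodeState.Sound.items_transmit {m₀ : List Bool} {X : Finset (Sym2 ℕ)} {q : NodeState}
    (h : q.Sound m₀ X) (sl : Slot) {e : Evidence} (he : e ∈ items sl (q.transmit sl)) :
    e.Sound m₀ X := by
  cases sl with
  | relayAll =>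
    simp only [items, transmit, decodeEvidence_encodeEvidence] at he
    split at he
    · next m hm =>
      rw [Finset.mem_singleton] at he
      exact Or.inl (he ▸ h.accepted_eq hm)
    · exact h.ev e he
  | announce =>
    simp only [transmit] at he
    split at he
    · next m hm =>
      simp only [items, Finset.mem_singleton] at he
      exact Or.inl (he ▸ h.accepted_eq hm)
    · simp [items] at he
  | flood S =>
    simp only [transmit] at he
    split_ifs at he with hc
    · simp only [items, Finset.mem_singleton] at he
      obtain ⟨P, hPS, hP⟩ := hc.choose_spec
      exact he ▸ (h.ev _ hP).mono hPS
    · simp [items] at he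

section Correctness

variable {V : Type} [Fintype V] {σ : CommModel → ℕ → ℕ → ℕ → Slot} {M : CommModel}
  {I : BroadcastTask V} {F : Finset (Sym2 V)} {x : ℕ → V → V → List Bool}

/-- The faulty edges, as pairs of identifiers. -/
def faultyIds (I : BroadcastTask V) (F : Finset (Sym2 V)) : Finset (Sym2 ℕ) :=
  F.image (Sym2.map I.ident)

lemma nodeAt_sound (hI : Function.Injective I.ident) (hF : F.card ≤ I.faultBound) (r : ℕ) (v : V) :
    (nodeAt σ M I F x r v).Sound I.message (faultyIds I F) := by
  induction r generalizing v with
  | zero =>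
    refine ⟨fun e he => ?_, fun m hm => ?_, Finset.card_image_le.trans hF⟩
    · simp [nodeAt_zero, evidenceProtocol] at he
    · rw [nodeAt_inp, BroadcastTask.localInput] at hm
      simp only at hm
      split_ifs at hm
      exact (Option.some.inj hm).symm
  | succ r ih =>
    by_cases h : (nodeAt σ M I F x r v).out = none
    · have hinp : (nodeAt σ M I F x (r + 1) v).inp = (nodeAt σ M I F x r v).inp := by
        rw [nodeAt_inp, nodeAt_inp]
      refine ⟨fun e he => ?_, hinp ▸ (ih v).message, hinp ▸ (ih v).card_le⟩
      rcases (mem_ev_succ hI h).1 he with he | ⟨u, -, P, hP, heP⟩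
      · exact (ih v).ev e he
      · obtain ⟨Q, m⟩ := e
        simp only at heP hP
        subst heP
        rw [deliveredAt] at hP
        split_ifs at hP with hf
        -- Over a faulty edge anything may arrive, but the edge inserted by the receiver is itself
        -- faulty.
        · refine Or.inr fun hd => Finset.disjoint_left.1 hd (Finset.mem_insert_self _ _) ?_
          exact Finset.mem_image.2 ⟨_, hf, rfl⟩
        · rw [sentAt] at hP
          split_ifs at hP
          · exact ((ih u).items_transmit _ hP).mono (Finset.subset_insert _ _)
          · simp [items_nil] at hP
    · rw [nodeAt_succ_of_out _ _ _ _ _ h]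
      exact ih v

/-- Terminated nodes have the right output. -/
lemma out_eq_message (hI : Function.Injective I.ident) (hF : F.card ≤ I.faultBound) {r : ℕ} {v : V}
    (h : (nodeAt σ M I F x r v).out ≠ none) : (nodeAt σ M I F x r v).out = some I.message := by
  induction r with
  | zero =>
    obtain ⟨m, hm⟩ := Option.ne_none_iff_exists'.1 h
    have hm' : (nodeAt σ M I F x 0 v).inp.message = some m := by
      rw [nodeAt_zero] at hm
      simp only [evidenceProtocol] at hm
      split_ifs at hm
      exact hm
    rw [hm, (nodeAt_sound hI hF 0 v).message m hm']
  | succ r ih =>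
    by_cases h' : (nodeAt σ M I F x r v).out = none
    · obtain ⟨m, hm⟩ := Option.ne_none_iff_exists'.1 h
      have hacc : (nodeAt σ M I F x r v).accepted = some m := by
        rw [out_succ h'] at hm
        split at hm
        · simp at hm
        · exact hm
      rw [hm, (nodeAt_sound hI hF r v).accepted_eq hacc]
    · rw [nodeAt_succ_of_out _ _ _ _ _ h']
      exact ih h'

/-- The neighbours of a terminated node know its message. -/
lemma evidence_of_terminated (hI : Function.Injective I.ident) (hF : F.card ≤ I.faultBound)
    {r : ℕ} {v w : V} (hvw : I.graph.Adj v w) (hf : s(v, w) ∉ F)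
    (h : (nodeAt σ M I F x r v).out ≠ none) : (nodeAt σ M I F x r w).out ≠ none ∨
      ({s(I.ident v, I.ident w)}, I.message) ∈ (nodeAt σ M I F x r w).ev := by
  induction r with
  | zero =>
    exfalso
    rw [nodeAt_zero] at h
    simp only [evidenceProtocol] at h
    rw [if_neg] at h
    · exact h rfl
    · simp only [BroadcastTask.localInput]
      exact (Finset.Nonempty.image ⟨w, by simpa using hvw⟩ _).ne_empty
  | succ r ih =>
    by_cases hv : (nodeAt σ M I F x r v).out = none
    swap
    · rcases ih hv with h' | h'
      · rw [nodeAt_succ_of_out _ _ _ _ _ h']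
        exact Or.inl h'
      · exact Or.inr (ev_mono hI (Nat.le_succ r) w h')
    by_cases hw : (nodeAt σ M I F x r w).out = none
    swap
    · rw [nodeAt_succ_of_out _ _ _ _ _ hw]
      exact Or.inl hw
    right
    rw [out_succ hv] at h
    have hitem : (∅, I.message) ∈ items (slotOf σ M I r) (deliveredAt σ M I F x r v w) := by
      rw [deliveredAt, if_neg hf, sentAt, if_pos hv]
      have hacc : ∀ o, (nodeAt σ M I F x r v).accepted = o → o ≠ none → o = some I.message := by
        intro o ho hne
        obtain ⟨m, hm⟩ := Option.ne_none_iff_exists'.1 hne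
        rw [hm, (nodeAt_sound hI hF r v).accepted_eq (ho.trans hm)]
      cases hsl : slotOf σ M I r with
      | flood S => simp [hsl] at h
      | relayAll =>
        rw [hsl] at h
        simp [items, NodeState.transmit, decodeEvidence_encodeEvidence, hacc _ rfl h]
      | announce =>
        rw [hsl] at h
        simp [items, NodeState.transmit, hacc _ rfl h]
    exact (mem_ev_succ hI hw).2 (Or.inr ⟨v, hvw, ∅, hitem, by simp⟩)

/-! ### Completeness: information spreads along intact walks. -/

/-- The node `v` has terminated, or holds evidence inside `S` for the right message. -/
def Informed (σ : CommModel → ℕ → ℕ → ℕ → Slot) (M : CommModel) (I : BroadcastTask V)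
    (F : Finset (Sym2 V)) (x : ℕ → V → V → List Bool) (S : Finset (Sym2 ℕ)) (r : ℕ) (v : V) : Prop :=
  (nodeAt σ M I F x r v).out ≠ none ∨ ∃ P ⊆ S, (P, I.message) ∈ (nodeAt σ M I F x r v).ev

lemma Informed.mono (hI : Function.Injective I.ident) {S : Finset (Sym2 ℕ)} {r r' : ℕ}
    (hr : r ≤ r') {v : V} (h : Informed σ M I F x S r v) : Informed σ M I F x S r' v := by
  rcases h with h | ⟨P, hPS, hP⟩
  · exact Or.inl (by rwa [out_mono _ _ _ _ _ hr h])
  · exact Or.inr ⟨P, hPS, ev_mono hI hr v hP⟩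

/-- Rounds in which information passes along all edges of `S`. -/
def Slot.Carries (S : Finset (Sym2 ℕ)) : Slot → Prop
  | .relayAll => True
  | .announce => False
  | .flood S' => S' = S

/-- A terminated `v` has already given `w` the evidence consisting of the edge `vw` alone; otherwise
`v` transmits in this slot. -/
lemma Informed.step (hI : Function.Injective I.ident) (hF : F.card ≤ I.faultBound)
    {S : Finset (Sym2 ℕ)} (hS : Disjoint S (faultyIds I F)) {r : ℕ}
    (hsl : (slotOf σ M I r).Carries S) {v w : V} (hvw : I.graph.Adj v w)
    (hmem : s(I.ident v, I.ident w) ∈ S) (h : Informed σ M I F x S r v) :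
    Informed σ M I F x S (r + 1) w := by
  by_cases hw : (nodeAt σ M I F x r w).out = none
  swap
  · exact Informed.mono hI (Nat.le_succ r) (Or.inl hw)
  have hf : s(v, w) ∉ F := fun hf =>
    Finset.disjoint_left.1 hS hmem (Finset.mem_image.2 ⟨_, hf, rfl⟩)
  by_cases hv : (nodeAt σ M I F x r v).out = none
  swap
  · rcases evidence_of_terminated hI hF hvw hf hv with h' | h'
    · exact absurd hw h'
    · exact Informed.mono hI (Nat.le_succ r) (Or.inr ⟨_, by simpa using hmem, h'⟩)
  obtain ⟨P, hPS, hP⟩ := h.resolve_left (not_not_intro hv)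
  suffices hitem : ∃ Q ⊆ S,
      (Q, I.message) ∈ items (slotOf σ M I r) (deliveredAt σ M I F x r v w) by
    obtain ⟨Q, hQS, hQ⟩ := hitem
    exact Or.inr ⟨insert s(I.ident v, I.ident w) Q, Finset.insert_subset hmem hQS,
      (mem_ev_succ hI hw).2 (Or.inr ⟨v, hvw, Q, hQ, rfl⟩)⟩
  rw [deliveredAt, if_neg hf, sentAt, if_pos hv]
  cases hs : slotOf σ M I r with
  | announce => simp [hs, Slot.Carries] at hsl
  | relayAll =>
    simp only [items, NodeState.transmit, decodeEvidence_encodeEvidence]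
    split
    · next m hm =>
      rw [(nodeAt_sound hI hF r v).accepted_eq hm]
      exact ⟨∅, Finset.empty_subset _, Finset.mem_singleton_self _⟩
    · exact ⟨P, hPS, hP⟩
  | flood S' =>
    rw [hs] at hsl
    obtain rfl : S' = S := hsl
    have hc : ∃ m, ∃ P ⊆ S', (P, m) ∈ (nodeAt σ M I F x r v).ev := ⟨_, P, hPS, hP⟩
    simp only [NodeState.transmit, dif_pos hc]
    -- The message chosen for flooding may rest on other evidence than `P`, but evidence inside the
    -- fault-free set `S` can only be for the right message.
    obtain ⟨Q, hQS, hQ⟩ := hc.choose_spec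
    refine ⟨S', subset_rfl, ?_⟩
    simp only [items, Finset.mem_singleton, Prod.mk.injEq, true_and]
    exact ((((nodeAt_sound hI hF r v).ev _ hQ).mono hQS).resolve_right (not_not_intro hS)).symm

lemma Informed.walk (hI : Function.Injective I.ident) (hF : F.card ≤ I.faultBound)
    {S : Finset (Sym2 ℕ)} (hS : Disjoint S (faultyIds I F)) {v w : V} (p : I.graph.Walk v w)
    (hp : ∀ e ∈ p.edges, e.map I.ident ∈ S) {r L : ℕ} (hL : p.length ≤ L)
    (hsl : ∀ i < L, (slotOf σ M I (r + i)).Carries S) (h : Informed σ M I F x S r v) :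
    Informed σ M I F x S (r + L) w := by
  induction p generalizing r L with
  | nil => exact h.mono hI (Nat.le_add_right _ _)
  | @cons u v w huv p ih =>
    obtain _ | L := L
    · simp at hL
    simp only [SimpleGraph.Walk.edges_cons, List.mem_cons, forall_eq_or_imp] at hp
    rw [SimpleGraph.Walk.length_cons, Nat.add_le_add_iff_right] at hL
    have h1 := h.step hI hF hS (hsl 0 (Nat.succ_pos _)) huv hp.1
    have h2 := ih hp.2 hL (fun i hi => by
      have := hsl (i + 1) (by omega)
      rwa [← add_assoc, add_right_comm] at this) h1
    rwa [add_right_comm] at h2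

/-- The slots after which nodes with an accepted message terminate. -/
def Slot.Terminal : Slot → Prop
  | .flood _ => False
  | _ => True

lemma out_succ_ne_none_of_accepted {r : ℕ} {v : V} (hsl : (slotOf σ M I r).Terminal)
    (h : (nodeAt σ M I F x r v).accepted ≠ none) : (nodeAt σ M I F x (r + 1) v).out ≠ none := by
  by_cases hv : (nodeAt σ M I F x r v).out = none
  · rw [out_succ hv]
    cases hs : slotOf σ M I r with
    | flood S => simp [hs, Slot.Terminal] at hsl
    | relayAll => exact h
    | announce => exact h
  · rwa [nodeAt_succ_of_out _ _ _ _ _ hv]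

lemma out_succ_ne_none_of_informed {r : ℕ} {v : V}
    (hsl : (slotOf σ M I r).Terminal)
    (h : ∀ X : Finset (Sym2 ℕ), X.card ≤ I.faultBound →
      ∃ S, Disjoint S X ∧ Informed σ M I F x S r v) :
    (nodeAt σ M I F x (r + 1) v).out ≠ none := by
  by_cases hv : (nodeAt σ M I F x r v).out = none
  swap
  · rwa [nodeAt_succ_of_out _ _ _ _ _ hv]
  refine out_succ_ne_none_of_accepted hsl ?_
  have hc : ∃ m, Convincing I.faultBound (nodeAt σ M I F x r v).ev m := by
    refine ⟨I.message, fun X hX => ?_⟩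
    obtain ⟨S, hSX, hS⟩ := h X hX
    obtain ⟨P, hPS, hP⟩ := hS.resolve_left (not_not_intro hv)
    exact ⟨P, hP, hSX.mono_left hPS⟩
  rw [NodeState.accepted]
  split
  · simp
  · rw [dif_pos (by rw [nodeAt_inp]; exact hc)]
    simp

lemma source_terminates (h0 : (slotOf σ M I 0).Terminal) :
    (nodeAt σ M I F x 1 I.source).out ≠ none := by
  refine out_succ_ne_none_of_accepted h0 ?_
  have : (nodeAt σ M I F x 0 I.source).inp.message = some I.message := by
    simp [nodeAt_inp, BroadcastTask.localInput]
  simp [NodeState.accepted, this]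

/-- Broadcast is complete once, for all possible fault sets, the schedule has carried information
along an intact path to every node. -/
lemma all_terminate (hI : Function.Injective I.ident) (hF : F.card ≤ I.faultBound)
    (h0 : (slotOf σ M I 0).Terminal) {r : ℕ} (hr : (slotOf σ M I r).Terminal)
    (hcov : ∀ v, ∀ X : Finset (Sym2 ℕ), X.card ≤ I.faultBound →
      ∃ S, Disjoint S X ∧ Disjoint S (faultyIds I F) ∧ ∃ p : I.graph.Walk I.source v,
        (∀ e ∈ p.edges, e.map I.ident ∈ S) ∧ ∃ r₀ L, 1 ≤ r₀ ∧ r₀ + L ≤ r ∧ p.length ≤ L ∧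
          ∀ i < L, (slotOf σ M I (r₀ + i)).Carries S) (v : V) :
    (nodeAt σ M I F x (r + 1) v).out = some I.message := by
  refine out_eq_message hI hF (out_succ_ne_none_of_informed hr fun X hX => ?_)
  obtain ⟨S, hSX, hSF, p, hp, r₀, L, hr₀, hrL, hpL, hsl⟩ := hcov v X hX
  refine ⟨S, hSX, ?_⟩
  -- The source needs no evidence: it counts as informed because it terminates after round 0, whence
  -- the condition `1 ≤ r₀`.
  have hsrc : Informed σ M I F x S 1 I.source := Or.inl (source_terminates h0)
  exact ((hsrc.mono hI hr₀).walk hI hF hSF p hp hpL hsl).mono hI hrL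

/-- Without relaying of encoded evidence, messages are never longer than the source's message and
those of the adversary. -/
lemma length_sentAt_le (hI : Function.Injective I.ident) {B : ℕ} (hB : I.message.length + 1 ≤ B)
    (hx : ∀ r u v, (x r u v).length ≤ B) (hσ : ∀ r, slotOf σ M I r ≠ .relayAll) (r : ℕ) (u : V) :
    (sentAt σ M I F x r u).length ≤ B := by
  have htrans : ∀ q : NodeState, (∀ e ∈ q.ev, e.2.length + 1 ≤ B) →
      (∀ m, q.inp.message = some m → m.length + 1 ≤ B) → ∀ sl, sl ≠ Slot.relayAll →
      (q.transmit sl).length ≤ B := by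
    intro q hq hm sl hsl
    cases sl with
    | relayAll => exact absurd rfl hsl
    | announce =>
      simp only [NodeState.transmit]
      split
      · next m hacc =>
        rw [NodeState.accepted] at hacc
        split at hacc
        · next m' hm' => exact hm _ (hm'.trans hacc)
        · split_ifs at hacc with hc
          -- Convincing against the empty set means that some evidence for the message is held, so
          -- its length has been controlled on receipt.
          obtain ⟨P, hP, -⟩ := hc.choose_spec ∅ (by simp)
          rw [← Option.some.inj hacc]
          exact hq _ hP
      · simp
    | flood S =>
      simp only [NodeState.transmit]
      split_ifs with hc
      · obtain ⟨P, -, hP⟩ := hc.choose_spec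
        exact hq _ hP
      · simp
  have hmsg : ∀ r v m, (nodeAt σ M I F x r v).inp.message = some m → m.length + 1 ≤ B := by
    intro r v m hm
    rw [nodeAt_inp, BroadcastTask.localInput] at hm
    simp only at hm
    split_ifs at hm
    rwa [← Option.some.inj hm]
  -- Stripping the marker bit `true` on receipt pays for adding it on sending, so lengths do not
  -- grow from hop to hop.
  have hitems : ∀ sl l, sl ≠ Slot.relayAll → l.length ≤ B → ∀ e ∈ items sl l,
      e.2.length + 1 ≤ B := by
    intro sl l hsl hl e he
    rcases l with _ | ⟨_ | _, m⟩ <;> cases sl <;> simp_all [items]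
  have hsent : ∀ r, (∀ v, ∀ e ∈ (nodeAt σ M I F x r v).ev, e.2.length + 1 ≤ B) →
      ∀ u, (sentAt σ M I F x r u).length ≤ B := by
    intro r hr u
    rw [sentAt]
    split_ifs
    · exact htrans _ (hr u) (hmsg r u) _ (hσ r)
    · simp
  refine hsent r (fun v => ?_) u
  induction r generalizing v with
  | zero => simp [nodeAt_zero, evidenceProtocol]
  | succ r ih =>
    intro e he
    by_cases h : (nodeAt σ M I F x r v).out = none
    · rcases (mem_ev_succ hI h).1 he with he | ⟨u, -, P, hP, -⟩
      · exact ih v e he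
      · refine hitems _ _ (hσ r) ?_ (P, e.2) hP
        rw [deliveredAt]
        split_ifs
        · exact hx _ _ _
        · exact hsent r ih u
    · rw [nodeAt_succ_of_out _ _ _ _ _ h] at he
      exact ih v e he

end Correctness

/-! ### The CONGEST schedule and its length. -/

section Schedule

/-- One phase: flooding for `L` rounds in each member of a covering family. -/
def phaseSlots (t l L : ℕ) : List Slot :=
  (coveringFamily L (2 * t) l).flatMap fun S => List.replicate L (.flood S)

/-- The slots up to the end of phase `L`, each phase being followed by an announcement. -/
def slotsUpTo (t l : ℕ) : ℕ → List Slot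
  | 0 => [.announce]
  | L + 1 => slotsUpTo t l L ++ (phaseSlots t l (L + 1) ++ [.announce])

/-- The slot of round `r` in the bandwidth-restricted model. -/
def phasedSlot (t l r : ℕ) : Slot := (slotsUpTo t l r).getD r .announce

/-- Every phase contributes at least its announcement, so `phasedSlot` never falls back on its
default value. -/
lemma lt_length_slotsUpTo (t l L : ℕ) : L < (slotsUpTo t l L).length := by
  induction L with
  | zero => simp [slotsUpTo]
  | succ L ih => simp only [slotsUpTo, List.length_append, List.length_singleton]; omega

lemma slotsUpTo_prefix (t l : ℕ) {L L' : ℕ} (h : L ≤ L') :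
    slotsUpTo t l L <+: slotsUpTo t l L' := by
  induction L', h using Nat.le_induction with
  | base => exact List.prefix_rfl
  | succ k hk ih => exact ih.trans (List.prefix_append _ _)

lemma phasedSlot_eq {t l L r : ℕ} (hr : r < (slotsUpTo t l L).length) :
    phasedSlot t l r = (slotsUpTo t l L)[r] := by
  have hr' := lt_length_slotsUpTo t l r
  rw [phasedSlot, List.getD_eq_getElem _ _ hr']
  rcases le_total r L with h | h
  · exact (slotsUpTo_prefix t l h).getElem hr'
  · exact ((slotsUpTo_prefix t l h).getElem hr).symm

lemma phasedSlot_ne_relayAll (t l r : ℕ) : phasedSlot t l r ≠ .relayAll := by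
  have hall : ∀ L, ∀ sl ∈ slotsUpTo t l L, sl ≠ .relayAll := by
    intro L
    induction L with
    | zero => simp [slotsUpTo]
    | succ L ih =>
      intro sl hsl
      simp only [slotsUpTo, phaseSlots, List.mem_append, List.mem_flatMap, List.mem_replicate,
        List.mem_singleton] at hsl
      rcases hsl with h | ⟨S, -, -, rfl⟩ | rfl
      · exact ih sl h
      · simp
      · simp
  rw [phasedSlot_eq (lt_length_slotsUpTo t l r)]
  exact hall r _ (List.getElem_mem _)

lemma phasedSlot_last (t l L : ℕ) :
    phasedSlot t l ((slotsUpTo t l L).length - 1) = .announce := by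
  have hpos := lt_length_slotsUpTo t l L
  rw [phasedSlot_eq (L := L) (by omega), ← List.getLast_eq_getElem (by
    rw [← List.length_pos_iff]; omega)]
  cases L with
  | zero => simp [slotsUpTo]
  | succ L => simp [slotsUpTo]

/-- The block of `S` lies after the initial announcement and before the one closing the phase, the
margins that `all_terminate` needs. -/
lemma exists_flood_block {t l L : ℕ} {S : Finset (Sym2 ℕ)}
    (hS : S ∈ coveringFamily (L + 1) (2 * t) l) :
    ∃ r, 1 ≤ r ∧ r + (L + 1) ≤ (slotsUpTo t l (L + 1)).length - 1 ∧
      ∀ i < L + 1, phasedSlot t l (r + i) = .flood S := by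
  obtain ⟨l₁, l₂, hl⟩ := List.append_of_mem hS
  set A := slotsUpTo t l L ++ l₁.flatMap fun S => List.replicate (L + 1) (Slot.flood S) with hA
  set B := (l₂.flatMap fun S => List.replicate (L + 1) (Slot.flood S)) ++ [.announce] with hB
  have heq : slotsUpTo t l (L + 1) = A ++ (List.replicate (L + 1) (.flood S) ++ B) := by
    simp [slotsUpTo, phaseSlots, hl, hA, hB]
  have hlen : (slotsUpTo t l (L + 1)).length = A.length + (L + 1 + B.length) := by
    rw [heq]; simp
  have hA1 : 1 ≤ A.length := by
    have := lt_length_slotsUpTo t l L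
    simp only [hA, List.length_append]; omega
  have hB1 : 1 ≤ B.length := by simp [hB]
  refine ⟨A.length, hA1, by omega, fun i hi => ?_⟩
  rw [phasedSlot_eq (L := L + 1) (by omega)]
  simp only [heq]
  rw [List.getElem_append_right (by omega), List.getElem_append_left (by simp; omega)]
  simp

lemma length_phaseSlots (t l L : ℕ) :
    (phaseSlots t l L).length = (modulusBound L (2 * t) l + 1) ^ (2 * t + 1) * L := by
  simp [phaseSlots, List.length_flatMap, length_coveringFamily]

/-- Each phase is charged the cost of phase `L'`, which stays fixed while the induction runs over
`L`. -/
lemma length_slotsUpTo_le {t l L L' : ℕ} (h : L ≤ L') : (slotsUpTo t l L).length ≤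
    1 + L * ((modulusBound L' (2 * t) l + 1) ^ (2 * t + 1) * L' + 1) := by
  induction L with
  | zero => simp [slotsUpTo]
  | succ L ih =>
    have hmono : (phaseSlots t l (L + 1)).length ≤
        (modulusBound L' (2 * t) l + 1) ^ (2 * t + 1) * L' := by
      rw [length_phaseSlots, modulusBound, modulusBound]
      gcongr
    have := ih (by omega)
    simp only [slotsUpTo, List.length_append, List.length_singleton]
    rw [add_mul]
    omega

end Schedule

/-! ### Running the protocol on an admissible task. -/

/-- The number of bits known to suffice for identifiers. -/
def identBits (a N : ℕ) : ℕ := a * a * (Nat.log 2 N + 1)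

/-- The schedule in both models. -/
def broadcastSchedule (a : ℕ) : CommModel → ℕ → ℕ → ℕ → Slot
  | .congest, t, N, r => phasedSlot t (identBits a N) r
  | .unrestricted, _, _, _ => .relayAll

section Task

variable {V : Type} [Fintype V] {I : BroadcastTask V} {a : ℕ}

lemma BroadcastTask.Admissible.ident_lt_two_pow (h : I.Admissible a) (v : V) :
    I.ident v < 2 ^ identBits a I.sizeEstimate := by
  refine (h.ident_lt v).trans_le ?_
  calc Fintype.card V ^ a ≤ (I.sizeEstimate ^ a) ^ a := Nat.pow_le_pow_left h.card_le a
    _ ≤ ((2 ^ (Nat.log 2 I.sizeEstimate + 1)) ^ a) ^ a := by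
      gcongr
      exact (Nat.lt_pow_succ_log_self (by norm_num) _).le
    _ = 2 ^ identBits a I.sizeEstimate := by
      rw [← pow_mul, ← pow_mul, identBits]
      congr 1
      ring

/-- The length of intact paths in a task. -/
noncomputable def pathBound (I : BroadcastTask V) : ℕ :=
  (4 * I.faultBound + 1) * (2 * I.graph.diam + 1)

/-- The edges of `G` whose identifier pairs lie in `X` or are faulty number at most `2t`, by
injectivity of identifiers. Deleting them and applying `dist_deleteEdges_le` with `k = 2t` yields
`pathBound`. -/
lemma BroadcastTask.Admissible.exists_intact_walk (h : I.Admissible a) {F : Finset (Sym2 V)}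
    (hF : F.card ≤ I.faultBound) {X : Finset (Sym2 ℕ)} (hX : X.card ≤ I.faultBound) (v : V) :
    ∃ p : I.graph.Walk I.source v, p.length ≤ pathBound I ∧
      Disjoint (p.edges.map (Sym2.map I.ident)).toFinset (X ∪ faultyIds I F) := by
  classical
  set Y := Finset.univ.filter fun e : Sym2 V => e.map I.ident ∈ X ∪ faultyIds I F with hY
  have hYc : Y.card ≤ 2 * I.faultBound := by
    calc Y.card ≤ (X ∪ faultyIds I F).card :=
          Finset.card_le_card_of_injOn (Sym2.map I.ident)
            (fun e he => by simpa [hY] using he)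
            (Sym2.map.injective h.ident_injective).injOn
      _ ≤ X.card + (faultyIds I F).card := Finset.card_union_le _ _
      _ ≤ 2 * I.faultBound := by
        have : (faultyIds I F).card ≤ F.card := Finset.card_image_le
        omega
  have hreach : (I.graph.deleteEdges (Y : Set (Sym2 V))).Reachable I.source v :=
    h.edgeConnected _ _ (by
      rw [Set.encard_coe_eq_coe_finsetCard]; exact_mod_cast Nat.lt_succ_of_le hYc)
  obtain ⟨p, hp⟩ := hreach.exists_walk_length_eq_dist
  refine ⟨p.mapLe (SimpleGraph.deleteEdges_le _), ?_, ?_⟩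
  · have := dist_deleteEdges_le h.edgeConnected Y hYc I.source v
    rw [SimpleGraph.Walk.length_mapLe, hp, pathBound]
    refine this.trans (le_of_eq ?_)
    ring
  · rw [Finset.disjoint_left]
    intro e he hbad
    simp only [List.mem_toFinset, List.mem_map, SimpleGraph.Walk.edges_mapLe_eq_edges] at he
    obtain ⟨f, hf, rfl⟩ := he
    have hfe := p.edges_subset_edgeSet hf
    rw [SimpleGraph.edgeSet_deleteEdges] at hfe
    exact hfe.2 (by simpa [hY] using hbad)

lemma solvesWithin_of_subsingleton [Subsingleton V] (M : CommModel) (B : ℕ∞) {R : ℝ} (hR : 0 ≤ R)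
    (σ : CommModel → ℕ → ℕ → ℕ → Slot) : SolvesWithin (evidenceProtocol σ) M I B R := by
  intro F _ _ x _
  refine ⟨fun r u v huv => absurd (Subsingleton.elim u v) huv.ne, 0, by simpa using hR, fun v => ?_⟩
  obtain rfl : v = I.source := Subsingleton.elim _ _
  have hadj : ∀ u, ¬ I.graph.Adj I.source u := fun u hu => hu.ne (Subsingleton.elim _ _)
  simp [stateAt, evidenceProtocol, BroadcastTask.localInput, hadj]

lemma solvesWithin_unrestricted (h : I.Admissible a) {R : ℝ}
    (hR : ((pathBound I + 2 : ℕ) : ℝ) ≤ R) :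
    SolvesWithin (evidenceProtocol (broadcastSchedule a)) .unrestricted I ⊤ R := by
  intro F _ hF x _
  -- One round for the source to speak, `pathBound` rounds of relaying, and one to accept.
  -- `relayAll` carries every `S`, so the same rounds serve all `X`, with `S` the edge set of the
  -- walk.
  refine ⟨fun _ _ _ _ => le_top, pathBound I + 2, hR, ?_⟩
  have hsl : ∀ r, slotOf (broadcastSchedule a) .unrestricted I r = .relayAll := fun _ => rfl
  refine all_terminate (r := pathBound I + 1) h.ident_injective hF (by simp [hsl, Slot.Terminal])
    (by simp [hsl, Slot.Terminal]) fun v X hX => ?_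
  obtain ⟨p, hp, hd⟩ := h.exists_intact_walk hF hX v
  refine ⟨_, hd.mono_right Finset.subset_union_left, hd.mono_right Finset.subset_union_right, p,
    fun e he => List.mem_toFinset.2 (List.mem_map_of_mem he), 1, pathBound I, le_rfl, by omega, hp,
    fun i _ => by simp [hsl, Slot.Carries]⟩

lemma solvesWithin_congest (h : I.Admissible a) {B : ℕ} (hB : I.message.length + 1 ≤ B) {R : ℝ}
    (hR : ((slotsUpTo I.faultBound (identBits a I.sizeEstimate) (pathBound I)).length : ℝ) ≤ R) :
    SolvesWithin (evidenceProtocol (broadcastSchedule a)) .congest I B R := by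
  intro F _ hF x hx
  set t := I.faultBound with ht
  set l := identBits a I.sizeEstimate with hl
  have hsl : ∀ r, slotOf (broadcastSchedule a) .congest I r = phasedSlot t l r := fun _ => rfl
  constructor
  · intro r u v _
    rw [sentMsg_eq]
    exact_mod_cast length_sentAt_le h.ident_injective hB (fun r u v => by exact_mod_cast hx r u v)
      (fun r => by rw [hsl]; exact phasedSlot_ne_relayAll _ _ _) r u
  refine ⟨_, hR, ?_⟩
  have hlen := lt_length_slotsUpTo t l (pathBound I)
  obtain ⟨T, hT⟩ : ∃ T, (slotsUpTo t l (pathBound I)).length = T + 1 :=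
    ⟨_, (Nat.succ_pred_eq_of_pos (by omega)).symm⟩
  rw [hT]
  refine all_terminate h.ident_injective hF ?_ ?_ fun v X hX => ?_
  · simp [hsl, phasedSlot, slotsUpTo, Slot.Terminal]
  · have := phasedSlot_last t l (pathBound I)
    rw [hT, Nat.add_sub_cancel] at this
    simp [hsl, this, Slot.Terminal]
  · obtain ⟨p, hp, hd⟩ := h.exists_intact_walk hF hX v
    -- Phase `pathBound` is the decisive one, though no node can recognise it. `S` depends on `v`
    -- and `X`, but every member of the family has its block in this phase.
    obtain ⟨S, hS, hpS, hSd⟩ := exists_mem_coveringFamily (α := pathBound I) (β := 2 * t) (l := l)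
      ((List.toFinset_card_le _).trans (by simpa using hp))
      ((Finset.card_union_le _ _).trans (by
        have : (faultyIds I F).card ≤ F.card := Finset.card_image_le
        omega)) (fun e he => by
        simp only [List.mem_toFinset, List.mem_map] at he
        obtain ⟨f, -, rfl⟩ := he
        induction f with
        | _ u w =>
          rw [Sym2.map_mk, Finset.mk_mem_sym2_iff, Finset.mem_range, Finset.mem_range]
          exact ⟨h.ident_lt_two_pow u, h.ident_lt_two_pow w⟩) hd
    obtain ⟨L, hL⟩ : ∃ L, pathBound I = L + 1 :=
      ⟨pathBound I - 1, by have : 0 < pathBound I := by unfold pathBound; positivity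
                           omega⟩
    rw [hL] at hS hT
    obtain ⟨r₀, hr₀, hrL, hfl⟩ := exists_flood_block hS
    refine ⟨S, hSd.mono_right Finset.subset_union_left, hSd.mono_right Finset.subset_union_right,
      p, fun e he => hpS (List.mem_toFinset.2 (List.mem_map_of_mem he)), r₀, L + 1, hr₀, by omega,
      by omega, fun i hi => ?_⟩
    rw [hsl, hfl i hi]
    rfl

/-! ### Numerical estimates. -/

/-- Edge-connectivity forces all degrees to be at least `2t + 1 ≥ 3`. -/
lemma BroadcastTask.Admissible.four_le_card [Nontrivial V] (h : I.Admissible a) :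
    4 ≤ Fintype.card V := by
  classical
  have h1 := h.edgeConnected.le_degree (u := I.source)
  have h2 := I.graph.degree_lt_card_verts I.source
  have h3 := h.one_le_faultBound
  omega

lemma BroadcastTask.Admissible.one_le_diam [Nontrivial V] (h : I.Admissible a) :
    1 ≤ I.graph.diam :=
  Nat.one_le_iff_ne_zero.2
    (SimpleGraph.connected_iff_diam_ne_zero.1 (h.edgeConnected.connected (by simp)))

/-- Keeps the base `tD log n` of the round bound away from 1, so that constant factors can be
absorbed into the exponent. -/
lemma BroadcastTask.Admissible.four_thirds_le_log [Nontrivial V] (h : I.Admissible a) :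
    (4 / 3 : ℝ) ≤ Real.log (Fintype.card V) := by
  have h4 : (4 : ℝ) ≤ Fintype.card V := by exact_mod_cast h.four_le_card
  have h2 := Real.log_two_gt_d9
  calc (4 / 3 : ℝ) ≤ 2 * Real.log 2 := by linarith
    _ = Real.log 4 := by
      rw [← Real.log_rpow (by norm_num)]; norm_num
    _ ≤ _ := Real.log_le_log (by norm_num) h4

lemma pathBound_le [Nontrivial V] (h : I.Admissible a) :
    pathBound I ≤ 15 * (I.faultBound * I.graph.diam) := by
  have h1 := h.one_le_diam
  have h2 := h.one_le_faultBound
  calc pathBound I ≤ (5 * I.faultBound) * (3 * I.graph.diam) :=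
        Nat.mul_le_mul (by omega) (by omega)
    _ = _ := by ring

lemma identBits_le [Nontrivial V] (h : I.Admissible a) :
    (identBits a I.sizeEstimate : ℝ) ≤
      (a * a * (2 * a + 1) : ℕ) * Real.log (Fintype.card V) := by
  have hlog := h.four_thirds_le_log
  have h2 := Real.log_two_gt_d9
  have hN : 1 ≤ I.sizeEstimate := by
    by_contra! h0
    have h0 : I.sizeEstimate = 0 := by omega
    have h4 := h.four_le_card
    have := h.card_le
    rw [h0] at this
    have := this.trans (pow_le_one₀ le_rfl zero_le_one)
    omega
  -- The factor 2 comes from `log 2 > 1/2`. The remaining `+ 1` in `identBits` is absorbed by `1 ≤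
  -- log n`.
  have hlogN : (Nat.log 2 I.sizeEstimate : ℝ) ≤ 2 * (a * Real.log (Fintype.card V)) := by
    have h1 : ((2 : ℝ) ^ Nat.log 2 I.sizeEstimate) ≤ (Fintype.card V : ℝ) ^ a := by
      exact_mod_cast (Nat.pow_log_le_self 2 (by omega)).trans h.le_card
    have h3 := Real.log_le_log (by positivity) h1
    rw [Real.log_pow, Real.log_pow] at h3
    nlinarith [Nat.cast_nonneg (α := ℝ) (Nat.log 2 I.sizeEstimate)]
  rw [identBits]
  push_cast
  rw [mul_assoc ((a : ℝ) * a)]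
  refine mul_le_mul_of_nonneg_left ?_ (by positivity)
  nlinarith

/-- Bernoulli's inequality: `3c` steps of size at least `1/3` gain at least `c`. -/
lemma le_pow_of_four_thirds_le {X : ℝ} (hX : 4 / 3 ≤ X) (c : ℕ) : (c : ℝ) ≤ X ^ (3 * c) := by
  have h := one_add_mul_le_pow (a := X - 1) (by linarith) (3 * c)
  rw [add_sub_cancel] at h
  push_cast at h
  nlinarith [Nat.cast_nonneg (α := ℝ) c]

/-- The constant in the bound on the modulus. -/
def modulusConst (a : ℕ) : ℕ := 120 * (a * a * (2 * a + 1)) + 3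

/-- The length is at most `Q ^ (6 * t)`, where `Q` exceeds the largest modulus by one. Since `L =
O(tD)` and `l = O(log n)`, `Q` is at most a constant times `X ^ 2`, and the constant becomes a power
of `X`. -/
lemma length_slotsUpTo_pathBound_le [Nontrivial V] (h : I.Admissible a) {X : ℝ}
    (hX : X = (I.faultBound : ℝ) * I.graph.diam * Real.log (Fintype.card V)) :
    ((slotsUpTo I.faultBound (identBits a I.sizeEstimate) (pathBound I)).length : ℝ) ≤
      X ^ ((3 * modulusConst a + 2) * (6 * I.faultBound)) := by
  have hD : (1 : ℝ) ≤ I.graph.diam := by exact_mod_cast h.one_le_diam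
  have ht : (1 : ℝ) ≤ I.faultBound := by exact_mod_cast h.one_le_faultBound
  have ht' := h.one_le_faultBound
  have hlog := h.four_thirds_le_log
  have hlb := identBits_le h
  have hpb : (pathBound I : ℝ) ≤ 15 * (I.faultBound * I.graph.diam) := by
    exact_mod_cast pathBound_le h
  have ha : a ≠ 0 := by
    rintro rfl
    have h1 := h.card_le
    have h2 := h.four_le_card
    simp at h1
    omega
  have hl1 : 1 ≤ identBits a I.sizeEstimate :=
    Nat.one_le_iff_ne_zero.2 (by simp [identBits, ha])
  set t := I.faultBound
  set l := identBits a I.sizeEstimate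
  set L := pathBound I
  set Q := modulusBound L (2 * t) l + 1 with hQ
  have hQ' : Q = 8 * (L * t * l) + 3 := by rw [hQ, modulusBound]; ring
  have hLQ : L + 1 ≤ Q := by
    have : L * 1 * 1 ≤ L * t * l := Nat.mul_le_mul (Nat.mul_le_mul le_rfl ht') hl1
    omega
  have hlen : (slotsUpTo t l L).length ≤ Q ^ (6 * t) := by
    calc (slotsUpTo t l L).length ≤ 1 + L * (Q ^ (2 * t + 1) * L + 1) :=
          length_slotsUpTo_le le_rfl
      _ = (L + 1) + Q ^ (2 * t + 1) * (L * L) := by ring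
      _ ≤ Q ^ 1 + Q ^ (2 * t + 1) * (Q * Q) := by
        rw [pow_one]; gcongr <;> omega
      _ ≤ Q ^ (2 * t + 3) + Q ^ (2 * t + 3) := by
        refine Nat.add_le_add (Nat.pow_le_pow_right (by omega) (by omega)) (le_of_eq (by ring))
      _ = 2 * Q ^ (2 * t + 3) := by ring
      _ ≤ Q * Q ^ (2 * t + 3) := Nat.mul_le_mul_right _ (by omega)
      _ = Q ^ (2 * t + 4) := by ring
      _ ≤ Q ^ (6 * t) := Nat.pow_le_pow_right (by omega) (by omega)
  have htD : (1 : ℝ) ≤ t * I.graph.diam := one_le_mul_of_one_le_of_one_le ht hD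
  have hXlog : Real.log (Fintype.card V) ≤ X := by
    rw [hX]; exact le_mul_of_one_le_left (by linarith) htD
  have htX : (t : ℝ) ≤ X := by
    rw [hX, mul_assoc]
    exact le_mul_of_one_le_right (by linarith)
      (one_le_mul_of_one_le_of_one_le hD (by linarith))
  have hX43 : 4 / 3 ≤ X := hlog.trans hXlog
  have hQX : (Q : ℝ) ≤ X ^ (3 * modulusConst a + 2) := by
    set c := a * a * (2 * a + 1) with hc
    have hLl : (L : ℝ) * l ≤ 15 * c * X := by
      calc (L : ℝ) * l ≤ (15 * (t * I.graph.diam)) * (c * Real.log (Fintype.card V)) := by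
            gcongr
        _ = 15 * c * X := by rw [hX]; ring
    calc (Q : ℝ) = 8 * (L * l * t) + 3 := by rw [hQ']; push_cast; ring
      _ ≤ 8 * (15 * c * X * X) + 3 * X ^ 2 := by
        refine add_le_add ?_ (by nlinarith)
        gcongr
      _ = modulusConst a * X ^ 2 := by rw [modulusConst, ← hc]; push_cast; ring
      _ ≤ X ^ (3 * modulusConst a) * X ^ 2 := by
        gcongr
        exact le_pow_of_four_thirds_le hX43 _
      _ = _ := (pow_add _ _ _).symm
  calc ((slotsUpTo t l L).length : ℝ) ≤ (Q : ℝ) ^ (6 * t) := by exact_mod_cast hlen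
    _ ≤ (X ^ (3 * modulusConst a + 2)) ^ (6 * t) := by gcongr
    _ = _ := (pow_mul _ _ _).symm

end Task

end AdvBroadcast

theorem theorem2 (a : ℕ) :
    ∃ (C : ℕ) (A : AdvBroadcast.Protocol),
      ∀ (V : Type) [Fintype V] (I : AdvBroadcast.BroadcastTask V), I.Admissible a →
        (I.message.length ≤ a * Nat.log 2 (Fintype.card V) →
          AdvBroadcast.SolvesWithin A .congest I
            ((C * Nat.log 2 (Fintype.card V) : ℕ) : ℕ∞)
            (((I.faultBound : ℝ) * (I.graph.diam : ℝ) * Real.log (Fintype.card V : ℝ)) ^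
              (C * I.faultBound))) ∧
        AdvBroadcast.SolvesWithin A .unrestricted I ⊤
          ((C : ℝ) * ((I.faultBound : ℝ) * (I.graph.diam : ℝ) *
            Real.log (Fintype.card V : ℝ))) := by
  open AdvBroadcast in
  -- The first summand is the CONGEST exponent per unit of `t`; `a + 1` pays for the message and its
  -- marker bit. The sum also exceeds the 17 needed in LOCAL, 15 from `pathBound_le` and 2 for the
  -- first and last rounds.
  refine ⟨(3 * modulusConst a + 2) * 6 + a + 1, evidenceProtocol (broadcastSchedule a),
    fun V _ I h => ?_⟩
  have hlog0 : 0 ≤ Real.log (Fintype.card V : ℝ) := Real.log_natCast_nonneg _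
  rcases subsingleton_or_nontrivial V with hV | hV
  · exact ⟨fun _ => solvesWithin_of_subsingleton _ _ (by positivity) _,
      solvesWithin_of_subsingleton _ _ (by positivity) _⟩
  have hlog := h.four_thirds_le_log
  have htD : (1 : ℝ) ≤ I.faultBound * I.graph.diam := by
    exact_mod_cast Nat.mul_le_mul h.one_le_faultBound h.one_le_diam
  have hX : Real.log (Fintype.card V : ℝ) ≤
      I.faultBound * I.graph.diam * Real.log (Fintype.card V : ℝ) :=
    le_mul_of_one_le_left hlog0 htD
  refine ⟨fun hm => solvesWithin_congest h ?_ ?_, solvesWithin_unrestricted h ?_⟩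
  · have h1 : 1 ≤ Nat.log 2 (Fintype.card V) :=
      Nat.log_pos (by norm_num) (by have := h.four_le_card; omega)
    calc I.message.length + 1 ≤ a * Nat.log 2 (Fintype.card V) + Nat.log 2 (Fintype.card V) :=
          Nat.add_le_add hm h1
      _ = (a + 1) * Nat.log 2 (Fintype.card V) := by ring
      _ ≤ _ := Nat.mul_le_mul_right _ (by omega)
  · refine (length_slotsUpTo_pathBound_le h rfl).trans (pow_le_pow_right₀ (by linarith) ?_)
    rw [← mul_assoc]
    exact Nat.mul_le_mul_right _ (by omega)
  · have hpb : (pathBound I : ℝ) ≤ 15 * (I.faultBound * I.graph.diam) := by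
      exact_mod_cast pathBound_le h
    have hC : (17 : ℝ) ≤ (((3 * modulusConst a + 2) * 6 + a + 1 : ℕ) : ℝ) := by
      exact_mod_cast (by unfold modulusConst; omega :
        17 ≤ (3 * modulusConst a + 2) * 6 + a + 1)
    -- The LOCAL run takes only `O(tD)` rounds; the logarithm enters as a factor that is at least 1.
    calc ((pathBound I + 2 : ℕ) : ℝ) ≤ 17 * (I.faultBound * I.graph.diam) := by
          push_cast; linarith
      _ ≤ 17 * (I.faultBound * I.graph.diam * Real.log (Fintype.card V : ℝ)) := by
        refine mul_le_mul_of_nonneg_left ?_ (by norm_num)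
        exact le_mul_of_one_le_right (by linarith) (by linarith)
      _ ≤ _ := by gcongr
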